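/- Notation. All Euler characteristics are additive ones: for a locally compact Hausdorff space $Y$, $\chi(Y)=\sum_i(-1)^i\dim H^i_c(Y;\mathbb Q)$; for a space $Y$ that is not locally compact, $\chi(Y)$ is the sum of the Euler characteristics of its canonical locally compact pieces (the open set of points of $Y$ with a compact neighbourhood, then the same set for the closed remainder, and so on). We say that $\chi(Y)$ is defined if $Y$ is Hausdorff, is the union of finitely many such pieces, and each piece has finite-dimensional total cohomology with compact supports. The integral of an integer-valued function is $\int_Y f\,d\chi=\sum_{q\in\mathbb Z}q\,\chi(\{f=q\})$; it is defined if $f$ takes finitely many values and the Euler characteristics of all its level sets are defined. For a topological group $G$ acting on a topological space $X$, let $G_*$ be the space of conjugacy classes of elements of $G$ with the quotient topology, $C_G(g)$ the centralizer of $g$, and $X^{\langle g\rangle}$ the set of points fixed by $g$. The orbifold Euler characteristics of order $k\ge 0$ are $$\chi^{(0)}(X,G)=\chi(X/G),\qquad \chi^{(k)}(X,G)=\int_{G_*}\chi^{(k-1)}\bigl(X^{\langle g\rangle},C_G(g)\bigr)\,d\chi\quad(k\ge 1),$$ and $\chi^{(k)}(X,G)$ is said to be defined if all Euler characteristics and integrals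 in this recursion are. (In a formula, a dimension, sum or integral that is infinite or undefined is given the value $0$ by convention.) Lemma. Let $G$ be a compact Lie group, let $X$ be a topological space with a continuous action of $G$, and let $c$ be an element of the centre of $G$ that acts trivially on $X$. Let $G\cdot\langle a\rangle$ be a topological group that contains $G$ as a closed subgroup and is generated by $G$ and an element $a$ that commutes with all the elements of $G$, such that $\langle a\rangle\cap G=\langle c\rangle$ and $a^r=c$, where $r\ge 1$ is the least positive integer with $a^r\in G$. Then there is exactly one action of $G\cdot\langle a\rangle$ on $X$ that extends the action of $G$ and in which $a$ acts trivially; this action is continuous; and, for it and for every $k\ge 0$, if $\chi^{(k)}(X,G)$ is defined then so is $\chi^{(k)}(X,G\cdot\langle a\rangle)$, and $$\chi^{(k)}(X,G\cdot\langle a\rangle)=r^k\cdot\chi^{(k)}(X,G).$$ (The equality holds also, with the above conventions, when $\chi^{(k)}(X,G)$ is not defined.) -/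

import Mathlib

open scoped Manifold ContDiff Topology

universe u v w

namespace OrbEuler

/-! ### Cohomology with compact supports (Alexander-Spanier cochains, rational coefficients) -/

section Cohomology

variable (Y : Type u) [TopologicalSpace Y]

/-- Alexander-Spanier `n`-cochains: arbitrary functions of `n + 1` points. -/
abbrev Cochain (Y : Type u) (n : ℕ) : Type u := (Fin (n + 1) → Y) → ℚ

variable {Y} in
/-- The cochain `f` vanishes near `y`, that is, `y` is outside the support of `f`. -/
def VanishesNear {n : ℕ} (f : Cochain Y n) (y : Y) : Prop :=
  ∃ U ∈ 𝓝 y, ∀ p : Fin (n + 1) → Y, (∀ i, p i ∈ U) → f p = 0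

variable {Y} in
theorem VanishesNear.add {n : ℕ} {f g : Cochain Y n} {y : Y} (hf : VanishesNear f y)
    (hg : VanishesNear g y) : VanishesNear (f + g) y := by
  obtain ⟨U, hU, h1⟩ := hf
  obtain ⟨V, hV, h2⟩ := hg
  refine ⟨U ∩ V, Filter.inter_mem hU hV, fun p hp => ?_⟩
  simp [h1 p fun i => (hp i).1, h2 p fun i => (hp i).2]

variable {Y} in
theorem VanishesNear.smul {n : ℕ} {f : Cochain Y n} {y : Y} (t : ℚ) (hf : VanishesNear f y) :
    VanishesNear (t • f) y := by
  obtain ⟨U, hU, h1⟩ := hf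
  exact ⟨U, hU, fun p hp => by simp [h1 p hp]⟩

variable {Y} in
theorem vanishesNear_zero {n : ℕ} (y : Y) : VanishesNear (0 : Cochain Y n) y :=
  ⟨Set.univ, Filter.univ_mem, fun _ _ => rfl⟩

/-- Cochains with empty support (they vanish in a neighbourhood of the diagonal). -/
def locallyZero (n : ℕ) : Submodule ℚ (Cochain Y n) where
  carrier := {f | ∀ y, VanishesNear f y}
  add_mem' hf hg y := (hf y).add (hg y)
  zero_mem' := vanishesNear_zero
  smul_mem' t _ hf y := (hf y).smul t

/-- Cochains with compact support. The support is closed, so it is compact as soon as it lies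
in a compact set. -/
def compactlySupported (n : ℕ) : Submodule ℚ (Cochain Y n) where
  carrier := {f | ∃ K : Set Y, IsCompact K ∧ ∀ y, y ∉ K → VanishesNear f y}
  add_mem' := by
    rintro f g ⟨K, hK, hf⟩ ⟨L, hL, hg⟩
    exact ⟨K ∪ L, hK.union hL, fun y hy =>
      (hf y fun h => hy (Or.inl h)).add (hg y fun h => hy (Or.inr h))⟩
  zero_mem' := ⟨∅, isCompact_empty, fun y _ => vanishesNear_zero y⟩
  smul_mem' := by
    rintro t f ⟨K, hK, hf⟩
    exact ⟨K, hK, fun y hy => (hf y hy).smul t⟩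

/-- The coboundary `(δ f)(y₀, …, yₙ₊₁) = ∑ᵢ (-1)ⁱ f(y₀, …, ŷᵢ, …, yₙ₊₁)`. -/
def coboundary (n : ℕ) : Cochain Y n →ₗ[ℚ] Cochain Y (n + 1) where
  toFun f p := ∑ i : Fin (n + 2), (-1) ^ (i : ℕ) * f (p ∘ i.succAbove)
  map_add' f g := by
    funext p
    simp [mul_add, Finset.sum_add_distrib]
  map_smul' t f := by
    funext p
    simp only [Pi.smul_apply, smul_eq_mul, RingHom.id_apply, Finset.mul_sum]
    exact Finset.sum_congr rfl fun i _ => by ring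

/-- Representatives of the cocycles of the complex
`compactlySupported Y n ⧸ locallyZero Y n`, `n ≥ 0`. -/
def cocycles (n : ℕ) : Submodule ℚ (Cochain Y n) :=
  compactlySupported Y n ⊓ (locallyZero Y (n + 1)).comap (coboundary Y n)

/-- Representatives of the coboundaries of the same complex. -/
def coboundaries : (n : ℕ) → Submodule ℚ (Cochain Y n)
  | 0 => locallyZero Y 0
  | n + 1 => locallyZero Y (n + 1) ⊔ (compactlySupported Y n).map (coboundary Y n)

/-- The cohomology with compact supports `H_c^n(Y; ℚ)`. -/
abbrev CompactCohomology (n : ℕ) : Type u :=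
  cocycles Y n ⧸ (coboundaries Y n).comap (cocycles Y n).subtype

/-- The total cohomology with compact supports is finite dimensional. -/
def FiniteType : Prop :=
  (∀ n, FiniteDimensional ℚ (CompactCohomology Y n)) ∧
    ∃ N, ∀ n, N ≤ n → Subsingleton (CompactCohomology Y n)

/-- The alternating sum of the dimensions of `H_c^n(Y; ℚ)`. -/
noncomputable def compactEulerChar : ℤ :=
  ∑ᶠ n : ℕ, (-1) ^ n * (Module.finrank ℚ (CompactCohomology Y n) : ℤ)

end Cohomology

/-! ### The additive Euler characteristic

On a locally compact Hausdorff space it is the Euler characteristic of the cohomology with compact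
supports. Unions of strata (for instance level sets of constructible functions) need not be locally
compact. They are cut into locally compact pieces in the canonical way: split off the open set of
the points with a compact neighbourhood, then do the same with the closed remainder, and so on. -/

section Euler

variable {Y : Type u} [TopologicalSpace Y]

/-- The points of `S` that have a compact neighbourhood in `S`. -/
def lcPart (S : Set Y) : Set Y :=
  {y ∈ S | ∃ K : Set Y, K ⊆ S ∧ IsCompact K ∧ K ∈ 𝓝[S] y}

variable (Y) in
/-- What is left of `Y` after `n` steps. -/
def remainder : ℕ → Set Y
  | 0 => Set.univ
  | n + 1 => remainder n \ lcPart (remainder n)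

variable (Y) in
/-- The `n`-th locally compact piece of `Y`. For a locally compact space the piece number `0` is
everything. -/
def piece (n : ℕ) : Set Y := lcPart (remainder Y n)

variable (Y) in
/-- The Euler characteristic of `Y` makes sense: `Y` is Hausdorff, it is the union of finitely many
of its pieces, and these have finite dimensional cohomology with compact supports. -/
def HasEulerChar : Prop :=
  T2Space Y ∧ (∃ n, remainder Y n = ∅) ∧ ∀ n, FiniteType (piece Y n)

variable (Y) in
/-- The additive Euler characteristic. -/
noncomputable def eulerChar : ℤ := ∑ᶠ n : ℕ, compactEulerChar (piece Y n)

/-- `f` is integrable with respect to the Euler characteristic: it takes finitely many values, and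
the Euler characteristics of its level sets make sense. -/
def EulerIntegrable (f : Y → ℤ) : Prop :=
  (Set.range f).Finite ∧ ∀ q : ℤ, HasEulerChar {y | f y = q}

/-- The integral with respect to the Euler characteristic, `∫ f dχ = ∑_q q · χ(f = q)`. -/
noncomputable def eulerIntegral (f : Y → ℤ) : ℤ := ∑ᶠ q : ℤ, q * eulerChar {y | f y = q}

end Euler

/-! ### Orbifold Euler characteristics of higher order -/

section Orbifold

/-- The space `G_*` of conjugacy classes, with the quotient topology. -/
instance conjClassesTopology (G : Type u) [Group G] [TopologicalSpace G] :
    TopologicalSpace (ConjClasses G) :=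
  inferInstanceAs (TopologicalSpace (Quotient (IsConj.setoid G)))

/-- The centralizer `C_G(g)` acts on the fixed point set of `g` (the same as that of `⟨g⟩`). -/
instance centralizerAction {G : Type u} {X : Type v} [Group G] [MulAction G X] (g : G) :
    MulAction (Subgroup.centralizer {g}) (MulAction.fixedBy X g) where
  smul h x := ⟨(h : G) • (x : X), by
    have hx : g • (x : X) = x := x.2
    have hc : (h : G) * g = g * h := (Subgroup.mem_centralizer_singleton_iff.mp h.2)
    change g • (h : G) • (x : X) = (h : G) • (x : X)
    rw [← mul_smul, ← hc, mul_smul, hx]⟩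
  one_smul x := Subtype.ext (one_smul G (x : X))
  mul_smul h h' x := Subtype.ext (mul_smul (h : G) (h' : G) (x : X))

/-- The orbifold Euler characteristic `χ^(k)(X, G)` of order `k`. In the integrand a conjugacy class
is represented by one of its elements; another representative gives an isomorphic pair. -/
noncomputable def orbifoldEulerChar : ℕ → ∀ (X : Type v) (G : Type u) [TopologicalSpace X]
    [Group G] [TopologicalSpace G] [MulAction G X], ℤ
  | 0, X, G, _, _, _, _ => eulerChar (Quotient (MulAction.orbitRel G X))
  | k + 1, X, G, _, _, _, _ => eulerIntegral fun C : ConjClasses G =>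
      orbifoldEulerChar k (MulAction.fixedBy X (Quotient.out C))
        (Subgroup.centralizer {(Quotient.out C : G)})

/-- `χ^(k)(X, G)` makes sense: all the Euler characteristics and the integrals in its
definition do. -/
def HasOrbifoldEulerChar : ℕ → ∀ (X : Type v) (G : Type u) [TopologicalSpace X]
    [Group G] [TopologicalSpace G] [MulAction G X], Prop
  | 0, X, G, _, _, _, _ => HasEulerChar (Quotient (MulAction.orbitRel G X))
  | k + 1, X, G, _, _, _, _ =>
      (∀ C : ConjClasses G, HasOrbifoldEulerChar k (MulAction.fixedBy X (Quotient.out C))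
        (Subgroup.centralizer {(Quotient.out C : G)})) ∧
      EulerIntegrable fun C : ConjClasses G =>
        orbifoldEulerChar k (MulAction.fixedBy X (Quotient.out C))
          (Subgroup.centralizer {(Quotient.out C : G)})

/-- The action `act` of `G'` on `X` extends the given action of `G` along `ι`, and `a` acts
trivially. -/
def ExtendsTrivially {G : Type u} {G' : Type w} {X : Type v} [Group G] [Group G'] [MulAction G X]
    (ι : G →* G') (a : G') (act : MulAction G' X) : Prop :=
  (∀ (g : G) (x : X), act.toSMul.smul (ι g) x = g • x) ∧ ∀ x : X, act.toSMul.smul a x = x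

end Orbifold

end OrbEuler

/-!
# Adjoining a commuting element that acts trivially

Every element of `G' = G · ⟨a⟩` is `aⁱ g` with unique `0 ≤ i < r` and `g ∈ G`. As `G` is closed, `G'`
is the topological disjoint union of the `r` cosets `aⁱ G`. It acts through `aⁱ g ↦ g`, which is well
defined because powers of `a` in `G` are powers of `c`, so `G` and `G'` have the same orbits; this
is the case `k = 0`.

Since `a` commutes with `G`, the elements `aⁱ g` and `aʲ h` are conjugate in `G'` exactly when `i = j`
and `g`, `h` are conjugate in `G`. Hence `G'_*` consists of `r` disjoint copies of `G_*`
(`PairExtension.conjClasses`). The fixed points of `aⁱ g` are those of `g`, and the centralizer of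
`aⁱ g` is `C_G(g) · ⟨a⟩` (`PairExtension.fixedPoints`), so the situation reproduces itself and the
integrand for `G'` is `r ^ k` times the integrand for `G`. The space of conjugacy classes
contributes one more factor `r`, by additivity of the Euler characteristic for finitely many disjoint
copies of a space (`eulerChar_copies`, `eulerIntegral_copies`). This additivity holds without
finiteness assumptions: a dimension or sum that is infinite for one copy is infinite for `r ≥ 1`
copies, and then both sides have the conventional value `0`.
-/

namespace OrbEuler

/-! ### Compactly supported cohomology of finitely many disjoint copies of a space -/

/-- Over a field this needs no finiteness: for a non-empty finite `J` both sides are `0` when `V`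
is infinite dimensional. -/
theorem finrank_finite_pi_const {K V J : Type*} [Field K] [AddCommGroup V] [Module K V]
    [Finite J] [Nonempty J] : Module.finrank K (J → V) = Nat.card J * Module.finrank K V := by
  have := Fintype.ofFinite J
  by_cases hV : Module.Finite K V
  · rw [Module.finrank_pi_fintype]
    simp
  · rw [Module.finrank_of_not_finite hV, mul_zero]
    refine Module.finrank_of_not_finite fun h => hV ?_
    obtain ⟨j⟩ := ‹Nonempty J›
    exact Module.Finite.of_surjective (LinearMap.proj j : (J → V) →ₗ[K] V)
      (LinearMap.proj_surjective j)

section Copies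

variable {Y : Type u} {Y' : Type w} {J : Type*} [TopologicalSpace Y] [TopologicalSpace Y']
  [TopologicalSpace J]

/-- Restriction of cochains on `Y' ≃ₜ Y × J` to the copy of `Y` with index `j`. -/
def restrictCopy (e : Y' ≃ₜ Y × J) (j : J) (n : ℕ) : Cochain Y' n →ₗ[ℚ] Cochain Y n :=
  LinearMap.funLeft ℚ ℚ fun (q : Fin (n + 1) → Y) m => e.symm (q m, j)

theorem restrictCopy_apply (e : Y' ≃ₜ Y × J) (j : J) {n : ℕ} (f : Cochain Y' n)
    (q : Fin (n + 1) → Y) : restrictCopy e j n f q = f fun m => e.symm (q m, j) := rfl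

theorem restrictCopy_coboundary (e : Y' ≃ₜ Y × J) (j : J) (n : ℕ) (f : Cochain Y' n) :
    restrictCopy e j (n + 1) (coboundary Y' n f) = coboundary Y n (restrictCopy e j n f) := rfl

/-- Cochains on the copies come from a cochain on `Y'`: extend by zero to the tuples whose entries
do not all lie in one copy. -/
theorem exists_restrictCopy_eq (e : Y' ≃ₜ Y × J) {n : ℕ} (f : J → Cochain Y n) :
    ∃ F : Cochain Y' n, ∀ j, restrictCopy e j n F = f j := by
  classical
  refine ⟨fun p => if ∀ m, (e (p m)).2 = (e (p 0)).2 then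
    f (e (p 0)).2 fun m => (e (p m)).1 else 0, fun j => ?_⟩
  funext q
  simp [restrictCopy_apply]

section Cohomology

variable [DiscreteTopology J]

theorem vanishesNear_restrictCopy (e : Y' ≃ₜ Y × J) (j : J) {n : ℕ} (f : Cochain Y' n) (y : Y) :
    VanishesNear (restrictCopy e j n f) y ↔ VanishesNear f (e.symm (y, j)) := by
  constructor
  · rintro ⟨U, hU, h⟩
    -- The copies are open, so the neighbourhood can be taken inside the copy with index `j`.
    refine ⟨e ⁻¹' (U ×ˢ {j}), e.continuous.continuousAt.preimage_mem_nhds ?_, fun p hp => ?_⟩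
    · rw [e.apply_symm_apply]
      exact prod_mem_nhds hU (by simp)
    · have := h (fun m => (e (p m)).1) fun m => (hp m).1
      rw [restrictCopy_apply] at this
      convert this using 2
      funext m
      rw [Homeomorph.eq_symm_apply]
      exact Prod.ext rfl (hp m).2
  · rintro ⟨U, hU, h⟩
    refine ⟨(fun y => e.symm (y, j)) ⁻¹' U, ?_, fun q hq => h _ hq⟩
    exact ContinuousAt.preimage_mem_nhds (by fun_prop) hU

theorem mem_locallyZero_iff_restrictCopy (e : Y' ≃ₜ Y × J) {n : ℕ} (f : Cochain Y' n) :
    f ∈ locallyZero Y' n ↔ ∀ j, restrictCopy e j n f ∈ locallyZero Y n := by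
  refine ⟨fun h j y => (vanishesNear_restrictCopy e j f y).2 (h _), fun h y => ?_⟩
  have := (vanishesNear_restrictCopy e (e y).2 f (e y).1).1 (h _ _)
  simpa using this

variable [Finite J]

theorem mem_compactlySupported_iff_restrictCopy (e : Y' ≃ₜ Y × J) {n : ℕ} (f : Cochain Y' n) :
    f ∈ compactlySupported Y' n ↔ ∀ j, restrictCopy e j n f ∈ compactlySupported Y n := by
  constructor
  · rintro ⟨K, hK, h⟩ j
    refine ⟨(fun y => (e y).1) '' K, hK.image (by fun_prop), fun y hy => ?_⟩
    exact (vanishesNear_restrictCopy e j f y).2 (h _ fun hy' => hy ⟨_, hy', by simp⟩)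
  · intro h
    choose K hK h using h
    refine ⟨⋃ j, (fun y => e.symm (y, j)) '' K j,
      isCompact_iUnion fun j => (hK j).image (by fun_prop), fun y hy => ?_⟩
    have := (vanishesNear_restrictCopy e (e y).2 f (e y).1).1 (h _ _ fun hy' =>
      hy (Set.mem_iUnion.2 ⟨(e y).2, _, hy', by simp⟩))
    simpa using this

theorem mem_cocycles_iff_restrictCopy (e : Y' ≃ₜ Y × J) {n : ℕ} (f : Cochain Y' n) :
    f ∈ cocycles Y' n ↔ ∀ j, restrictCopy e j n f ∈ cocycles Y n := by
  simp only [cocycles, Submodule.mem_inf, Submodule.mem_comap,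
    mem_compactlySupported_iff_restrictCopy e, mem_locallyZero_iff_restrictCopy e,
    restrictCopy_coboundary, forall_and]

theorem mem_coboundaries_iff_restrictCopy (e : Y' ≃ₜ Y × J) {n : ℕ} (f : Cochain Y' n) :
    f ∈ coboundaries Y' n ↔ ∀ j, restrictCopy e j n f ∈ coboundaries Y n := by
  cases n with
  | zero => exact mem_locallyZero_iff_restrictCopy e f
  | succ n =>
    simp only [coboundaries, Submodule.mem_sup, Submodule.mem_map]
    constructor
    · rintro ⟨z, hz, _, ⟨g, hg, rfl⟩, rfl⟩ j
      exact ⟨_, (mem_locallyZero_iff_restrictCopy e z).1 hz j, _,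
        ⟨_, (mem_compactlySupported_iff_restrictCopy e g).1 hg j, rfl⟩, by
          rw [map_add, restrictCopy_coboundary]⟩
    · intro h
      choose z hz b hb h using h
      choose g hg hgb using hb
      -- The cochains `g j` come from one cochain `G` on `Y'`, and `f - δ G` is locally zero.
      obtain ⟨G, hG⟩ := exists_restrictCopy_eq e g
      refine ⟨f - coboundary Y' n G, (mem_locallyZero_iff_restrictCopy e _).2 fun j => ?_, _,
        ⟨G, (mem_compactlySupported_iff_restrictCopy e G).2 fun j => (hG j).symm ▸ hg j, rfl⟩,
        sub_add_cancel _ _⟩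
      rw [map_sub, restrictCopy_coboundary, hG, hgb, ← h, add_sub_cancel_right]
      exact hz j

/-- The cohomology with compact supports of finitely many disjoint copies of `Y`. -/
noncomputable def compactCohomologyCopies (e : Y' ≃ₜ Y × J) (n : ℕ) :
    CompactCohomology Y' n ≃ₗ[ℚ] (J → CompactCohomology Y n) :=
  let φ : cocycles Y' n →ₗ[ℚ] (J → CompactCohomology Y n) := LinearMap.pi fun j =>
    Submodule.mkQ _ ∘ₗ (restrictCopy e j n).restrict fun f hf =>
      (mem_cocycles_iff_restrictCopy e f).1 hf j
  have hker : (coboundaries Y' n).comap (cocycles Y' n).subtype = LinearMap.ker φ := by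
    ext f
    rw [LinearMap.mem_ker, funext_iff]
    simp only [φ, LinearMap.pi_apply, LinearMap.comp_apply, Submodule.mkQ_apply, Pi.zero_apply,
      Submodule.Quotient.mk_eq_zero]
    exact mem_coboundaries_iff_restrictCopy e f.1
  have hsurj : Function.Surjective φ := by
    intro z
    choose g hg using fun j => Submodule.mkQ_surjective _ (z j)
    obtain ⟨F, hF⟩ := exists_restrictCopy_eq e fun j => (g j).1
    refine ⟨⟨F, (mem_cocycles_iff_restrictCopy e F).2 fun j => hF j ▸ (g j).2⟩, ?_⟩
    funext j
    rw [← hg]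
    exact congrArg _ (Subtype.ext (hF j))
  (Submodule.quotEquivOfEq _ _ hker).trans (φ.quotKerEquivOfSurjective hsurj)

theorem FiniteType.copies (e : Y' ≃ₜ Y × J) (h : FiniteType Y) : FiniteType Y' := by
  obtain ⟨h1, N, h2⟩ := h
  refine ⟨fun n => ?_, N, fun n hn => ?_⟩
  · have := h1 n
    exact Module.Finite.equiv (compactCohomologyCopies e n).symm
  · have := h2 n hn
    exact (compactCohomologyCopies e n).toEquiv.subsingleton

theorem compactEulerChar_copies [Nonempty J] (e : Y' ≃ₜ Y × J) :
    compactEulerChar Y' = Nat.card J * compactEulerChar Y := by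
  rw [compactEulerChar, compactEulerChar, ← smul_eq_mul, smul_finsum]
  refine finsum_congr fun n => ?_
  rw [(compactCohomologyCopies e n).finrank_eq, finrank_finite_pi_const]
  push_cast
  simp only [smul_eq_mul]
  ring

end Cohomology

/-! ### The additive Euler characteristic of finitely many disjoint copies of a space -/

/-- The part of `Y' ≃ₜ Y × J` that lies over a subset of `Y`. -/
def copiesPreimage (e : Y' ≃ₜ Y × J) {S : Set Y} {S' : Set Y'}
    (h : S' = (fun y => (e y).1) ⁻¹' S) : S' ≃ₜ S × J where
  toFun y := (⟨(e y).1, by subst h; exact y.2⟩, (e y).2)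
  invFun z := ⟨e.symm (z.1, z.2), by subst h; simp⟩
  left_inv y := by simp
  right_inv z := by simp
  continuous_toFun := by fun_prop
  continuous_invFun := by fun_prop

theorem levelSet_copies {f : Y → ℤ} {f' : Y' → ℤ} {m : ℤ}
    (e : Y' ≃ₜ Y × J) (hm : m ≠ 0) (hf : ∀ y, f' y = m * f (e y).1) (q : ℤ) :
    {y | f' y = m * q} = (fun y => (e y).1) ⁻¹' {y | f y = q} := by
  ext y
  simp [hf, hm]

theorem levelSet_eq_empty {f : Y → ℤ} {f' : Y' → ℤ} {m : ℤ}
    (e : Y' ≃ₜ Y × J) (hf : ∀ y, f' y = m * f (e y).1) {q : ℤ}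
    (hq : ¬ m ∣ q) : IsEmpty {y | f' y = q} :=
  ⟨fun y => hq ⟨_, y.2.symm.trans (hf y)⟩⟩

variable [Finite J]

theorem lcPart_copies (e : Y' ≃ₜ Y × J) (S : Set Y) :
    lcPart ((fun y => (e y).1) ⁻¹' S) = (fun y => (e y).1) ⁻¹' lcPart S := by
  have hcont : Continuous fun y => (e y).1 := by fun_prop
  have hopen : IsOpenMap fun y => (e y).1 := isOpenMap_fst.comp e.isOpenMap
  ext y
  have hmap : Filter.map (fun y => (e y).1) (𝓝[(fun y => (e y).1) ⁻¹' S] y) = 𝓝[S] (e y).1 := by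
    rw [nhdsWithin, Filter.map_inf_principal_preimage, hopen.map_nhds_eq hcont.continuousAt,
      nhdsWithin]
  refine and_congr Iff.rfl ⟨?_, ?_⟩
  · rintro ⟨K, hKS, hK, hKy⟩
    exact ⟨_, Set.image_subset_iff.2 hKS, hK.image hcont, hmap ▸ Filter.image_mem_map hKy⟩
  · rintro ⟨K, hKS, hK, hKy⟩
    refine ⟨(fun y => (e y).1) ⁻¹' K, Set.preimage_mono hKS, ?_, ?_⟩
    · have : (fun y => (e y).1) ⁻¹' K = e ⁻¹' (K ×ˢ Set.univ) := by ext; simp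
      rw [this, e.isCompact_preimage]
      exact hK.prod isCompact_univ
    · rw [← hmap] at hKy
      exact hKy

theorem remainder_copies (e : Y' ≃ₜ Y × J) (n : ℕ) :
    remainder Y' n = (fun y => (e y).1) ⁻¹' remainder Y n := by
  induction n with
  | zero => rfl
  | succ n ih => rw [remainder, ih, lcPart_copies]; rfl

theorem piece_copies (e : Y' ≃ₜ Y × J) (n : ℕ) :
    piece Y' n = (fun y => (e y).1) ⁻¹' piece Y n := by
  rw [piece, remainder_copies e, lcPart_copies]
  rfl

variable [DiscreteTopology J]

theorem HasEulerChar.copies (e : Y' ≃ₜ Y × J) (h : HasEulerChar Y) : HasEulerChar Y' := by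
  obtain ⟨h1, ⟨n, hn⟩, h2⟩ := h
  refine ⟨e.symm.t2Space, ⟨n, ?_⟩, fun n => (h2 n).copies (copiesPreimage e (piece_copies e n))⟩
  rw [remainder_copies e, hn, Set.preimage_empty]

theorem eulerChar_copies [Nonempty J] (e : Y' ≃ₜ Y × J) :
    eulerChar Y' = Nat.card J * eulerChar Y := by
  rw [eulerChar, eulerChar, ← smul_eq_mul, smul_finsum]
  exact finsum_congr fun n => compactEulerChar_copies (copiesPreimage e (piece_copies e n))

theorem hasEulerChar_of_isEmpty {Z : Type*} [TopologicalSpace Z] [IsEmpty Z] : HasEulerChar Z := by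
  refine ⟨inferInstance, ⟨0, Subsingleton.elim _ _⟩, fun n => ?_⟩
  have (m : ℕ) : Subsingleton (CompactCohomology (piece Z n) m) := inferInstance
  exact ⟨fun m => inferInstance, 0, fun m _ => this m⟩

theorem eulerChar_of_isEmpty {Z : Type*} [TopologicalSpace Z] [IsEmpty Z] : eulerChar Z = 0 := by
  have (n m : ℕ) : Module.finrank ℚ (CompactCohomology (piece Z n) m) = 0 :=
    Module.finrank_zero_of_subsingleton
  simp [eulerChar, compactEulerChar, this]

section Integral

variable {f : Y → ℤ} {f' : Y' → ℤ} {m : ℤ}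

theorem EulerIntegrable.copies (e : Y' ≃ₜ Y × J) (hm : m ≠ 0) (hf : ∀ y, f' y = m * f (e y).1)
    (h : EulerIntegrable f) : EulerIntegrable f' := by
  refine ⟨(h.1.image (m * ·)).subset ?_, fun q => ?_⟩
  · rintro _ ⟨y, rfl⟩
    exact ⟨_, ⟨_, rfl⟩, (hf y).symm⟩
  · by_cases hq : m ∣ q
    · obtain ⟨q, rfl⟩ := hq
      exact (h.2 q).copies (copiesPreimage e (levelSet_copies e hm hf q))
    · have := levelSet_eq_empty e hf hq
      exact hasEulerChar_of_isEmpty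

theorem eulerIntegral_copies [Nonempty J] (e : Y' ≃ₜ Y × J) (hm : m ≠ 0)
    (hf : ∀ y, f' y = m * f (e y).1) :
    eulerIntegral f' = m * Nat.card J * eulerIntegral f := by
  -- Only the multiples of `m` are values of `f'`, so the sum can be indexed by them.
  have hsupp : (Function.support fun q : ℤ => q * eulerChar {y | f' y = q}) ⊆
      Set.range (m * ·) := by
    intro q hq
    by_contra hmq
    have := levelSet_eq_empty e hf (q := q) fun ⟨s, hs⟩ => hmq ⟨s, hs.symm⟩
    exact hq (by simp only [eulerChar_of_isEmpty, mul_zero])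
  rw [eulerIntegral, eulerIntegral, ← finsum_mem_univ,
    ← finsum_mem_inter_support, Set.univ_inter, ← Set.inter_eq_right.2 hsupp,
    finsum_mem_inter_support,
    finsum_mem_range (mul_right_injective₀ hm), ← smul_eq_mul (_ * _), smul_finsum]
  refine finsum_congr fun q => ?_
  rw [eulerChar_copies (copiesPreimage e (levelSet_copies e hm hf q)), smul_eq_mul]
  ring

end Integral

end Copies

end OrbEuler

namespace OrbEuler

/-! ### Central cyclic extensions of a pair of a space and a group -/

section Extension

/-- The pair `(X', G')` is, up to isomorphism, obtained from `(X, G)` by adjoining to `G` an element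
`a` that commutes with `G` and acts trivially on the space, in such a way that `G'` is the
topological disjoint union of the cosets `aⁱ G`, `0 ≤ i < r`. The value of `aʳ` does not matter.

The spaces are identified by a homeomorphism instead of being equal, so that the notion passes
to fixed point sets of elements of `G'` that are only conjugate to elements of the form `aⁱ g`. -/
structure PairExtension (X : Type v) (G : Type u) (X' : Type v) (G' : Type w) [TopologicalSpace X]
    [Group G] [TopologicalSpace G] [MulAction G X] [TopologicalSpace X'] [Group G']
    [TopologicalSpace G'] [MulAction G' X'] (r : ℕ) where
  /-- The inclusion of `G`. -/
  ι : G →* G'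
  /-- The adjoined element. -/
  a : G'
  commute (g : G) : Commute a (ι g)
  /-- The decomposition into cosets. -/
  coset : G × Fin r ≃ₜ G'
  coset_apply (g : G) (i : Fin r) : coset (g, i) = a ^ (i : ℕ) * ι g
  /-- The identification of the spaces. -/
  space : X' ≃ₜ X
  space_smul (g : G) (x : X') : space (ι g • x) = g • space x
  smul_eq (x : X') : a • x = x

namespace PairExtension

variable {X : Type v} {G : Type u} {X' : Type v} {G' : Type w} [TopologicalSpace X]
  [Group G] [TopologicalSpace G] [MulAction G X] [TopologicalSpace X'] [Group G']
  [TopologicalSpace G'] [MulAction G' X'] {r : ℕ} (P : PairExtension X G X' G' r)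

theorem pow_smul_eq (n : ℕ) (x : X') : P.a ^ n • x = x := by
  induction n with
  | zero => simp
  | succ n ih => rw [pow_succ, mul_smul, P.smul_eq, ih]

theorem space_coset_smul (z : G × Fin r) (x : X') :
    P.space (P.coset z • x) = z.1 • P.space x := by
  rw [P.coset_apply, mul_smul, P.pow_smul_eq, P.space_smul]

/-- The two groups have the same orbits. -/
noncomputable def orbitSpace (hr : 0 < r) : Quotient (MulAction.orbitRel G' X') ≃ₜ
    Quotient (MulAction.orbitRel G X) where
  toFun := Quotient.map' P.space <| by
    rintro x y ⟨g, rfl⟩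
    refine ⟨(P.coset.symm g).1, ?_⟩
    change _ • P.space y = P.space (g • y)
    rw [← P.space_coset_smul, P.coset.apply_symm_apply]
  invFun := Quotient.map' P.space.symm <| by
    rintro x y ⟨g, rfl⟩
    refine ⟨P.coset (g, ⟨0, hr⟩), ?_⟩
    apply P.space.injective
    change P.space (_ • P.space.symm y) = P.space (P.space.symm (g • y))
    simp [P.space_coset_smul]
  left_inv x := by
    induction x using Quotient.inductionOn'
    simp
  right_inv x := by
    induction x using Quotient.inductionOn'
    simp
  continuous_toFun := P.space.continuous.quotient_map' _
  continuous_invFun := P.space.symm.continuous.quotient_map' _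

theorem coset_mul_coset_conj (g h : G) (i j : Fin r) :
    P.coset (h, j) * P.coset (g, i) * (P.coset (h, j))⁻¹ = P.coset (h * g * h⁻¹, i) := by
  simp only [P.coset_apply, map_mul, map_inv, mul_inv_rev]
  have h1 := (P.commute g).pow_left j
  have h2 := (P.commute h).pow_left i
  have h3 := (P.commute h).pow_left j
  calc _ = P.a ^ (j : ℕ) * (P.ι h * P.a ^ (i : ℕ)) * P.ι g * (P.ι h)⁻¹ * (P.a ^ (j : ℕ))⁻¹ := by
        group
    _ = P.a ^ (i : ℕ) * (P.a ^ (j : ℕ) * (P.ι h * P.ι g * (P.ι h)⁻¹)) * (P.a ^ (j : ℕ))⁻¹ := by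
        rw [← h2.eq]; group
    _ = _ := by
        have := ((h3.mul_right h1).mul_right h3.inv_right)
        rw [this.eq]; group

/-- Conjugation by elements of `G'` preserves the cosets, and the classes in a coset are those
of `G`. -/
noncomputable def conjClasses : ConjClasses G' ≃ₜ ConjClasses G × Fin r where
  toFun := Quotient.lift (fun g' => (ConjClasses.mk (P.coset.symm g').1, (P.coset.symm g').2)) <| by
    intro x y hxy
    obtain ⟨z, rfl⟩ := isConj_iff.1 hxy
    obtain ⟨⟨g, i⟩, rfl⟩ := P.coset.surjective x
    obtain ⟨⟨h, j⟩, rfl⟩ := P.coset.surjective z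
    rw [P.coset_mul_coset_conj]
    simp only [Homeomorph.symm_apply_apply, Prod.mk.injEq, and_true]
    exact ConjClasses.mk_eq_mk_iff_isConj.2 (isConj_iff.2 ⟨h, rfl⟩)
  invFun z := Quotient.lift (fun g => ConjClasses.mk (P.coset (g, z.2))) (by
    intro x y hxy
    obtain ⟨h, rfl⟩ := isConj_iff.1 hxy
    rw [← P.coset_mul_coset_conj x h z.2 z.2]
    exact ConjClasses.mk_eq_mk_iff_isConj.2 (isConj_iff.2 ⟨_, rfl⟩)) z.1
  left_inv x := by
    induction x using Quotient.inductionOn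
    exact congrArg ConjClasses.mk (P.coset.apply_symm_apply _)
  right_inv := by
    rintro ⟨x, i⟩
    induction x using Quotient.inductionOn with | _ g
    exact congrArg (fun z : G × Fin r => (ConjClasses.mk z.1, z.2))
      (P.coset.symm_apply_apply (g, i))
  continuous_toFun := by
    refine continuous_quot_lift _ ?_
    exact (continuous_quot_mk.comp (by fun_prop)).prodMk (by fun_prop)
  continuous_invFun := by
    rw [continuous_prod_of_discrete_right]
    intro i
    have h : Continuous fun g => ConjClasses.mk (P.coset (g, i)) :=
      continuous_quot_mk.comp (P.coset.continuous.comp (Continuous.prodMk_left i))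
    exact (isQuotientMap_quotient_mk' (s := IsConj.setoid G)).continuous_iff.2 h

theorem conjClasses_mk (g' : G') :
    P.conjClasses (ConjClasses.mk g') =
      (ConjClasses.mk (P.coset.symm g').1, (P.coset.symm g').2) := rfl

/-- Twisting by the inner automorphism `g ↦ s g s⁻¹` of `G`. -/
def conj [IsTopologicalGroup G] [ContinuousConstSMul G X] (s : G) :
    PairExtension X G X' G' r where
  ι := P.ι.comp (MulAut.conj s).toMonoidHom
  a := P.a
  commute g := P.commute _
  coset := (Homeomorph.prodCongr ((Homeomorph.mulLeft s).trans (Homeomorph.mulRight s⁻¹))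
    (Homeomorph.refl _)).trans P.coset
  coset_apply g i := P.coset_apply _ i
  space := P.space.trans (Homeomorph.smul s⁻¹)
  space_smul g x := by
    have h := P.space_smul s⁻¹ x
    rw [map_inv] at h
    simp [P.space_smul, mul_smul, h]
  smul_eq := P.smul_eq

theorem conj_coset [IsTopologicalGroup G] [ContinuousConstSMul G X] (s g : G) (i : Fin r) :
    (P.conj s).coset (g, i) = P.coset (s * g * s⁻¹, i) := rfl

theorem coset_mem_centralizer {g h : G} {i j : Fin r} :
    P.coset (h, j) ∈ Subgroup.centralizer {P.coset (g, i)} ↔ h ∈ Subgroup.centralizer {g} := by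
  rw [Subgroup.mem_centralizer_singleton_iff, Subgroup.mem_centralizer_singleton_iff,
    ← mul_inv_eq_iff_eq_mul, ← mul_inv_eq_iff_eq_mul, coset_mul_coset_conj]
  simp

theorem mem_fixedBy {g : G} {i : Fin r} {x : X'} :
    x ∈ MulAction.fixedBy X' (P.coset (g, i)) ↔ P.space x ∈ MulAction.fixedBy X g := by
  rw [MulAction.mem_fixedBy, MulAction.mem_fixedBy, ← P.space.injective.eq_iff,
    P.space_coset_smul]

/-- The centralizer of `aⁱ g` in `G'` is obtained from that of `g` in `G` by adjoining `a`, and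
the two elements have the same fixed points. -/
def fixedPoints {g' : G'} {g : G} {i : Fin r} (hg : P.coset (g, i) = g') :
    PairExtension (MulAction.fixedBy X g) (Subgroup.centralizer {g})
      (MulAction.fixedBy X' g') (Subgroup.centralizer {g'}) r where
  ι := (P.ι.comp (Subgroup.subtype _)).codRestrict _ fun h => by
    have h1 : P.coset (h, ⟨0, i.pos⟩) = P.ι h := by simp [P.coset_apply]
    rw [← hg, MonoidHom.comp_apply, Subgroup.subtype_apply, ← h1, P.coset_mem_centralizer]
    exact h.2
  a := ⟨P.a, by
    rw [← hg, Subgroup.mem_centralizer_singleton_iff, P.coset_apply]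
    exact ((Commute.refl P.a).pow_right _).mul_right (P.commute g)⟩
  commute h := Subtype.ext (P.commute h)
  coset :=
    { toFun z := ⟨P.coset (z.1, z.2), hg ▸ P.coset_mem_centralizer.2 z.1.2⟩
      invFun z := (⟨(P.coset.symm z).1, (P.coset_mem_centralizer (j := (P.coset.symm z).2)).1 <| by
        rw [Prod.mk.eta, P.coset.apply_symm_apply, hg]
        exact z.2⟩, (P.coset.symm z).2)
      left_inv z := by simp
      right_inv z := by simp
      continuous_toFun := by fun_prop
      continuous_invFun := by fun_prop }
  coset_apply h j := Subtype.ext (P.coset_apply h j)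
  space := P.space.subtype fun x => by rw [← hg, P.mem_fixedBy]
  space_smul h x := Subtype.ext (P.space_smul h x)
  smul_eq x := Subtype.ext (P.smul_eq x)

/-- A conjugacy class of `G'` is that of some `aⁱ g`, where `g` is the chosen representative of a
conjugacy class of `G`. -/
theorem exists_conj_coset_out [IsTopologicalGroup G] [ContinuousConstSMul G X]
    (C : ConjClasses G') : ∃ s : G,
      (P.conj s).coset (Quotient.out (P.conjClasses C).1, (P.conjClasses C).2) =
        Quotient.out C := by
  have hC : P.conjClasses C = (ConjClasses.mk (P.coset.symm (Quotient.out C)).1,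
      (P.coset.symm (Quotient.out C)).2) := by
    rw [← P.conjClasses_mk]
    exact congrArg P.conjClasses (Quotient.out_eq C).symm
  have h : IsConj (Quotient.out (P.conjClasses C).1) (P.coset.symm (Quotient.out C)).1 := by
    rw [← ConjClasses.mk_eq_mk_iff_isConj]
    exact (Quotient.out_eq _).trans (congrArg Prod.fst hC)
  obtain ⟨s, hs⟩ := isConj_iff.1 h
  have h2 : (P.conjClasses C).2 = (P.coset.symm (Quotient.out C)).2 := congrArg Prod.snd hC
  exact ⟨s, by rw [conj_coset, hs, h2, Prod.mk.eta, P.coset.apply_symm_apply]⟩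

end PairExtension

instance continuousConstSMul_fixedBy {G : Type u} {X : Type v} [Group G] [TopologicalSpace X]
    [MulAction G X] [ContinuousConstSMul G X] (g : G) :
    ContinuousConstSMul (Subgroup.centralizer {g}) (MulAction.fixedBy X g) where
  continuous_const_smul h :=
    ((continuous_const_smul (h : G)).comp continuous_subtype_val).subtype_mk _

/-- Each step of the recursion contributes a factor `r`, the number of copies of `ConjClasses G` in
`ConjClasses G'`. -/
theorem PairExtension.orbifoldEulerChar (k : ℕ) : ∀ {X : Type v} {G : Type u} {X' : Type v}
    {G' : Type w} [TopologicalSpace X] [Group G] [TopologicalSpace G] [MulAction G X]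
    [TopologicalSpace X'] [Group G'] [TopologicalSpace G'] [MulAction G' X']
    [IsTopologicalGroup G] [ContinuousConstSMul G X] {r : ℕ} (_ : 0 < r)
    (_ : PairExtension X G X' G' r),
    (HasOrbifoldEulerChar k X G → HasOrbifoldEulerChar k X' G') ∧
      orbifoldEulerChar k X' G' = (r : ℤ) ^ k * orbifoldEulerChar k X G := by
  induction k with
  | zero =>
    intro X G X' G' _ _ _ _ _ _ _ _ _ _ r hr P
    have e := (P.orbitSpace hr).trans (Homeomorph.prodUnique _ Unit).symm
    exact ⟨fun h => h.copies e, by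
      simpa [OrbEuler.orbifoldEulerChar] using eulerChar_copies e⟩
  | succ k ih =>
    intro X G X' G' _ _ _ _ _ _ _ _ _ _ r hr P
    have : Nonempty (Fin r) := ⟨⟨0, hr⟩⟩
    have hr' : (r : ℤ) ^ k ≠ 0 := pow_ne_zero _ (by exact_mod_cast hr.ne')
    choose s hs using P.exists_conj_coset_out
    have key C := ih hr ((P.conj (s C)).fixedPoints (hs C))
    refine ⟨fun h => ⟨fun C => (key C).1 (h.1 _), ?_⟩, ?_⟩
    · exact EulerIntegrable.copies P.conjClasses hr' (fun C => (key C).2) h.2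
    · refine (eulerIntegral_copies (f := fun C : ConjClasses G =>
        OrbEuler.orbifoldEulerChar k (MulAction.fixedBy X (Quotient.out C))
          (Subgroup.centralizer {(Quotient.out C : G)})) P.conjClasses hr'
        fun C => (key C).2).trans ?_
      rw [Nat.card_fin, ← pow_succ]
      rfl

end Extension

end OrbEuler

/-! ### The group generated by `G` and a commuting element -/

namespace OrbEuler

section Adjoin

variable {G : Type u} {G' : Type w} [Group G] [Group G'] {ι : G →* G'} {a : G'} {c : G} {r : ℕ}

theorem zpow_mul_mul_zpow_mul (hcomm : ∀ g : G, a * ι g = ι g * a) (n m : ℤ) (g h : G) :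
    a ^ n * ι g * (a ^ m * ι h) = a ^ (n + m) * ι (g * h) := by
  have := Commute.zpow_left (hcomm g) m
  rw [zpow_add, map_mul, mul_assoc, mul_assoc, ← mul_assoc (ι g), ← this.eq, mul_assoc]

theorem exists_zpow_mul_eq (hgen : ι.range ⊔ Subgroup.zpowers a = ⊤)
    (hcomm : ∀ g : G, a * ι g = ι g * a) (x : G') : ∃ (n : ℤ) (g : G), a ^ n * ι g = x := by
  have hx : x ∈ ι.range ⊔ Subgroup.zpowers a := hgen ▸ Subgroup.mem_top x
  rw [Subgroup.sup_eq_closure_mul] at hx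
  induction hx using Subgroup.closure_induction with
  | mem x hx =>
    obtain ⟨_, ⟨g, rfl⟩, _, ⟨n, rfl⟩, rfl⟩ := hx
    exact ⟨n, g, (Commute.zpow_left (hcomm g) n).eq⟩
  | one => exact ⟨0, 1, by simp⟩
  | mul x y _ _ hx hy =>
    obtain ⟨n, g, rfl⟩ := hx
    obtain ⟨m, h, rfl⟩ := hy
    exact ⟨n + m, g * h, (zpow_mul_mul_zpow_mul hcomm n m g h).symm⟩
  | inv x _ hx =>
    obtain ⟨n, g, rfl⟩ := hx
    refine ⟨-n, g⁻¹, ?_⟩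
    have := Commute.zpow_left (hcomm g) n
    rw [this.eq, mul_inv_rev, zpow_neg, map_inv]

/-- Two decompositions of an element of `G · ⟨a⟩` differ by a power of `c`. -/
theorem exists_eq_zpow_mul (hinj : Function.Injective ι)
    (hcap : Subgroup.zpowers a ⊓ ι.range = Subgroup.zpowers (ι c)) {n m : ℤ} {g h : G}
    (heq : a ^ n * ι g = a ^ m * ι h) : ∃ t : ℤ, g = c ^ t * h := by
  have h1 : ι (g * h⁻¹) = a ^ (m - n) := by
    rw [map_mul, map_inv, mul_inv_eq_iff_eq_mul, sub_eq_neg_add, zpow_add, mul_assoc, ← heq,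
      zpow_neg, inv_mul_cancel_left]
  have h2 : ι (g * h⁻¹) ∈ Subgroup.zpowers a ⊓ ι.range := ⟨⟨m - n, h1.symm⟩, _, rfl⟩
  rw [hcap] at h2
  obtain ⟨t, ht⟩ := h2
  refine ⟨t, mul_inv_eq_iff_eq_mul.1 (hinj ?_)⟩
  rw [← ht, map_zpow]

theorem zpow_smul_of_trivial {X : Type v} [MulAction G X] (hcX : ∀ x : X, c • x = x) (t : ℤ)
    (x : X) : c ^ t • x = x :=
  (MulAction.stabilizer G x).zpow_mem (hcX x) t

/-- The action of `G · ⟨a⟩` in which `aⁿ g` acts as `g`. It is well defined since `g` is unique up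
to powers of `c`. -/
theorem existsUnique_extendsTrivially {X : Type v} [MulAction G X] (hinj : Function.Injective ι)
    (hcX : ∀ x : X, c • x = x) (hgen : ι.range ⊔ Subgroup.zpowers a = ⊤)
    (hcomm : ∀ g : G, a * ι g = ι g * a)
    (hcap : Subgroup.zpowers a ⊓ ι.range = Subgroup.zpowers (ι c)) :
    ∃! act : MulAction G' X, ExtendsTrivially ι a act := by
  choose n p hp using exists_zpow_mul_eq hgen hcomm
  have hwd {m : ℤ} {g : G} {y : G'} (hy : a ^ m * ι g = y) (x : X) : p y • x = g • x := by
    obtain ⟨t, ht⟩ := exists_eq_zpow_mul hinj hcap ((hp y).trans hy.symm)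
    rw [ht, mul_smul, zpow_smul_of_trivial hcX]
  let act : MulAction G' X :=
    { smul y x := p y • x
      one_smul x := (hwd (m := 0) (g := 1) (by simp) x).trans (one_smul G x)
      mul_smul y z x := by
        refine (hwd (m := n y + n z) (g := p y * p z) ?_ x).trans (mul_smul _ _ _)
        rw [← zpow_mul_mul_zpow_mul hcomm, hp, hp] }
  refine ⟨act, ⟨fun g x => hwd (m := 0) (by simp) x, fun x => ?_⟩, fun act' h' => ?_⟩
  · exact (hwd (m := 1) (g := 1) (by simp) x).trans (one_smul G x)
  · refine MulAction.ext ?_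
    funext y x
    have ha (x : X) : act'.toSMul.smul a x = x := h'.2 x
    have hz : act'.toSMul.smul (a ^ n y) (act'.toSMul.smul (ι (p y)) x) =
        act'.toSMul.smul (ι (p y)) x :=
      letI := act'
      zpow_smul_of_trivial ha (n y) _
    calc act'.toSMul.smul y x = act'.toSMul.smul (a ^ n y * ι (p y)) x := by rw [hp]
      _ = act'.toSMul.smul (a ^ n y) (act'.toSMul.smul (ι (p y)) x) := act'.mul_smul _ _ _
      _ = p y • x := hz.trans (h'.1 _ _)

theorem bijective_pow_mul (hinj : Function.Injective ι)
    (hgen : ι.range ⊔ Subgroup.zpowers a = ⊤) (hcomm : ∀ g : G, a * ι g = ι g * a)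
    (hr : 0 < r) (har : a ^ r = ι c) (hmin : ∀ s : ℕ, 0 < s → s < r → a ^ s ∉ ι.range) :
    Function.Bijective fun z : G × Fin r => a ^ (z.2 : ℕ) * ι z.1 := by
  have hle {i j : Fin r} {g h : G} (hij : i ≤ j)
      (heq : a ^ (i : ℕ) * ι g = a ^ (j : ℕ) * ι h) : i = j := by
    by_contra hne
    have hlt : (i : ℕ) < j := lt_of_le_of_ne hij fun h => hne (Fin.ext h)
    refine hmin (j - i) (by omega) (by omega) ⟨g * h⁻¹, ?_⟩
    rw [map_mul, map_inv, mul_inv_eq_iff_eq_mul, ← mul_right_inj (a ^ (i : ℕ)), heq, ← mul_assoc,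
      ← pow_add, Nat.add_sub_cancel' hlt.le]
  constructor
  · rintro ⟨g, i⟩ ⟨h, j⟩ heq
    have hij : i = j := (le_total i j).elim (fun l => hle l heq) fun l => (hle l heq.symm).symm
    subst hij
    exact Prod.ext (hinj (mul_left_cancel heq)) rfl
  · intro x
    obtain ⟨n, g, rfl⟩ := exists_zpow_mul_eq hgen hcomm x
    have hr0 : (0 : ℤ) < r := by exact_mod_cast hr
    have h1 := Int.emod_nonneg n hr0.ne'
    have h2 := Int.emod_lt_of_pos n hr0
    refine ⟨(c ^ (n / r) * g, ⟨(n % r).toNat, by omega⟩), ?_⟩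
    simp only
    rw [← zpow_natCast, Int.toNat_of_nonneg h1, map_mul, map_zpow, ← har, ← zpow_natCast a r,
      ← zpow_mul, ← mul_assoc, ← zpow_add, Int.emod_add_mul_ediv]

/-- The closed subgroup `G` has finite index, so that `G · ⟨a⟩` is the topological disjoint union of
its cosets. -/
noncomputable def cosetHomeomorph [TopologicalSpace G] [TopologicalSpace G']
    [IsTopologicalGroup G'] (hι : Topology.IsClosedEmbedding ι)
    (hbij : Function.Bijective fun z : G × Fin r => a ^ (z.2 : ℕ) * ι z.1) : G × Fin r ≃ₜ G' :=
  (Equiv.ofBijective _ hbij).toHomeomorphOfContinuousClosed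
    (by
      refine continuous_prod_of_discrete_right.2 fun i => ?_
      exact (continuous_const_mul (a ^ (i : ℕ))).comp hι.continuous)
    (by
      intro F hF
      have h : (fun z : G × Fin r => a ^ (z.2 : ℕ) * ι z.1) '' F =
          ⋃ i : Fin r, (fun g => a ^ (i : ℕ) * ι g) '' {g | (g, i) ∈ F} := by
        ext x
        simp only [Set.mem_image, Set.mem_iUnion, Set.mem_ofPred_eq, Prod.exists]
        exact exists_comm
      change IsClosed ((fun z : G × Fin r => a ^ (z.2 : ℕ) * ι z.1) '' F)
      rw [h]
      refine isClosed_iUnion_of_finite fun i => ?_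
      exact ((isClosedMap_mul_left _).comp hι.isClosedMap) _ (hF.preimage (by fun_prop)))

end Adjoin

end OrbEuler

theorem lemma3
    -- `G` is a compact Lie group
    {E : Type*} [NormedAddCommGroup E] [NormedSpace ℝ E] [FiniteDimensional ℝ E]
    {G : Type u} [Group G] [TopologicalSpace G] [ChartedSpace E G] [LieGroup 𝓘(ℝ, E) ∞ G]
    [CompactSpace G] [T2Space G]
    -- `X` is a `G`-space
    {X : Type v} [TopologicalSpace X] [MulAction G X] [ContinuousSMul G X]
    -- `c` is central and acts trivially
    (c : G) (hc : c ∈ Subgroup.center G) (hcX : ∀ x : X, c • x = x)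
    -- `G'` is the group `G · ⟨a⟩`, which contains `G` as a closed subgroup through `ι`
    {G' : Type w} [Group G'] [TopologicalSpace G'] [IsTopologicalGroup G']
    (ι : G →* G') (hι : Topology.IsClosedEmbedding ι) (a : G')
    (hgen : ι.range ⊔ Subgroup.zpowers a = ⊤)
    (hcomm : ∀ g : G, a * ι g = ι g * a)
    (hcap : Subgroup.zpowers a ⊓ ι.range = Subgroup.zpowers (ι c))
    (r : ℕ) (hr : 0 < r) (har : a ^ r = ι c)
    (hmin : ∀ s : ℕ, 0 < s → s < r → a ^ s ∉ ι.range)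
    (k : ℕ) :
    (∃! act : MulAction G' X, OrbEuler.ExtendsTrivially ι a act) ∧
      ∀ [act : MulAction G' X], OrbEuler.ExtendsTrivially ι a act →
        ContinuousSMul G' X ∧
        (OrbEuler.HasOrbifoldEulerChar k X G → OrbEuler.HasOrbifoldEulerChar k X G') ∧
        OrbEuler.orbifoldEulerChar k X G' = (r : ℤ) ^ k * OrbEuler.orbifoldEulerChar k X G := by

  have hbij := OrbEuler.bijective_pow_mul hι.injective hgen hcomm hr har hmin
  refine ⟨OrbEuler.existsUnique_extendsTrivially hι.injective hcX hgen hcomm hcap, ?_⟩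
  intro act hact
  have : IsTopologicalGroup G := hι.isInducing.topologicalGroup ι
  let P : OrbEuler.PairExtension X G X G' r :=
    { ι := ι
      a := a
      commute := hcomm
      coset := OrbEuler.cosetHomeomorph hι hbij
      coset_apply := fun _ _ => rfl
      space := Homeomorph.refl X
      space_smul := hact.1
      smul_eq := hact.2 }
  refine ⟨⟨?_⟩, P.orbifoldEulerChar k hr⟩
  have hsmul (z : G' × X) : z.1 • z.2 = (P.coset.symm z.1).1 • z.2 := by
    refine Eq.trans ?_ (P.space_coset_smul (P.coset.symm z.1) z.2)
    rw [P.coset.apply_symm_apply]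
    rfl
  simp only [hsmul]
  fun_prop
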